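/- Let $n,r,d\ge 0$ be integers and let $\Delta$ be a finite $n$-dimensional simplicial complex embedded in $\mathbb{R}^n$, with $n$-simplices $\{\sigma_v\}_{v\in V}$. Call a simplicial complex strongly connected if it is pure (every simplex lies in a simplex of maximal dimension) and any two simplices of maximal dimension are joined by a chain of such simplices in which consecutive ones share a face of codimension one. Assume that $\Delta$ and the link of every simplex of $\Delta$ are strongly connected. Let $S^r_d(\Delta)$ be the $\mathbb{C}$-vector space of functions $F\colon\Delta\to\mathbb{C}$ that are continuously differentiable of order $r$ on the subspace $\Delta\subseteq\mathbb{R}^n$ and such that each restriction $F|_{\sigma_v}$ is a polynomial of degree at most $d$ with complex coefficients. Let $G_\Delta$ be the dual graph, with vertex set $V$ and an edge $uv$ whenever $\sigma_u\cap\sigma_v$ is an $(n-1)$-simplex, and let $\alpha_\Delta(uv)\subseteq\mathbb{C}[x_1,\dots,x_n]$ be the principal ideal generated by any nonzero affine linear form that vanishes on $\sigma_u\cap\sigma_v$. For a function $F$ whose restriction to each $\sigma_v$ is polynomial, let $F^*(v)\in\mathbb{C}[x_1,\dots,x_n]$ be the polynomial that equals $F$ on $\sigma_v$. Let $I_{d+1}$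 be the ideal of $\mathbb{C}[x_1,\dots,x_n]$ generated by all homogeneous elements of degree $d+1$, put $A=\mathbb{C}[x_1,\dots,x_n]/I_{d+1}$, and write bars for images in $A$; thus $\overline{F^*}\colon V\to A$. Let $$R_{G_\Delta,(\overline{\alpha_\Delta})^{r+1}}=\{p\colon V\to A \;:\; p(u)-p(v)\in (\overline{\alpha_\Delta(uv)})^{r+1}\text{ for every edge }uv\text{ of }G_\Delta\}$$ be the ring of generalized splines over $A$, with pointwise operations. Suppose that every ideal $\alpha_\Delta(uv)$ is generated by a homogeneous element. Then: 1. If $F\colon\Delta\to\mathbb{C}$ restricts to a polynomial of degree at most $d$ on each $\sigma_v$, then $F\in S^r_d(\Delta)$ if and only if $\overline{F^*}\in R_{G_\Delta,(\overline{\alpha_\Delta})^{r+1}}$. 2. The map $F\mapsto\overline{F^*}$ is an isomorphism of $\mathbb{C}$-vector spaces from $S^r_d(\Delta)$ onto $R_{G_\Delta,(\overline{\alpha_\Delta})^{r+1}}$. 3. If $f\in\mathbb{C}[x_1,\dots,x_n]$ and $p\in S^r_d(\Delta)$ satisfy $fp\in S^r_d(\Delta)$, then $\overline{(fp)^*}=\overline{f}\,\overline{p^*}$.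 4. If $p_1,p_2\in S^r_d(\Delta)$ satisfy $p_1p_2\in S^r_d(\Delta)$, then $\overline{(p_1p_2)^*}=\overline{p_1^*}\;\overline{p_2^*}$. -/

import Mathlib

noncomputable section

namespace SplinePaper

open MvPolynomial

/-! ### Generalized splines on an edge-labeled graph -/

/-- The ring `R_{G,α}` of splines on the edge-labeled graph `(G, α)` over the ring `R`: vertex
labelings whose values at the endpoints of every edge `uv` differ by an element of `α(uv)`.
Ring operations and the action of `R` are pointwise. -/
def splineRing {V R : Type*} [CommRing R] (G : SimpleGraph V) (α : G.edgeSet → Ideal R) :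
    Subalgebra R (V → R) where
  carrier := {p | ∀ (u v : V) (h : G.Adj u v), p u - p v ∈ α ⟨s(u, v), h⟩}
  mul_mem' := by
    intro p q hp hq u v h
    have e : (p * q) u - (p * q) v = p u * (q u - q v) + q v * (p u - p v) := by
      simp only [Pi.mul_apply]; ring
    rw [e]
    exact Ideal.add_mem _ (Ideal.mul_mem_left _ _ (hq u v h)) (Ideal.mul_mem_left _ _ (hp u v h))
  add_mem' := by
    intro p q hp hq u v h
    have e : (p + q) u - (p + q) v = (p u - p v) + (q u - q v) := by
      simp only [Pi.add_apply]; ring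
    rw [e]
    exact Ideal.add_mem _ (hp u v h) (hq u v h)
  algebraMap_mem' := by
    intro c u v h
    simp

/-! ### Simplicial complexes -/

open Classical in
/-- The link of the simplex `s` in an abstract simplicial complex `K`: the simplices `t`, disjoint
from `s`, such that `s ∪ t` is a simplex of `K`. (Simplices are nonempty by convention.) -/
def link {ι : Type*} (K : PreAbstractSimplicialComplex ι) (s : Finset ι) :
    PreAbstractSimplicialComplex ι where
  faces := {t | t.Nonempty ∧ Disjoint s t ∧ s ∪ t ∈ K.faces}
  isRelLowerSet_faces := by
    rintro t ⟨ht, hd, hw⟩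
    refine ⟨ht, fun t' hle hne => ⟨hne, hd.mono_right hle, ?_⟩⟩
    exact (K.isRelLowerSet_faces hw).2 (Finset.union_subset_union_right hle)
      (hne.mono Finset.subset_union_right)

open Classical in
/-- A simplicial complex is strongly connected if, for some `m`, each of its simplices lies in a
simplex with `m` vertices (so the complex is pure, of dimension `m - 1`), and any two simplices with
`m` vertices are joined by a chain of simplices with `m` vertices in which consecutive ones share a
common face with `m - 1` vertices (for `m = 1`, the empty face). -/
def IsStronglyConnected {ι : Type*} (K : PreAbstractSimplicialComplex ι) : Prop :=
  ∃ m : ℕ,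
    (∀ s ∈ K.faces, ∃ t ∈ K.faces, s ⊆ t ∧ t.card = m) ∧
    (∀ s ∈ K.faces, ∀ t ∈ K.faces, s.card = m → t.card = m →
      Relation.ReflTransGen
        (fun a b : Finset ι => b ∈ K.faces ∧ b.card = m ∧ (a ∩ b).card + 1 = m) s t)

/-- A simplicial complex is `n`-dimensional: it has an `n`-simplex, and no larger simplex. -/
def IsOfDimension {ι : Type*} (K : PreAbstractSimplicialComplex ι) (n : ℕ) : Prop :=
  (∃ s ∈ K.faces, s.card = n + 1) ∧ ∀ s ∈ K.faces, s.card ≤ n + 1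

/-! ### Classical splines and the dual graph of a complex in `ℝⁿ` -/

variable {n : ℕ}

/-- The value of a complex polynomial in `n` variables at a point of `ℝⁿ`. -/
def evalReal (x : EuclideanSpace ℝ (Fin n)) (P : MvPolynomial (Fin n) ℂ) : ℂ :=
  MvPolynomial.eval (fun i => (x i : ℂ)) P

variable (Δ : Geometry.SimplicialComplex ℝ (EuclideanSpace ℝ (Fin n)))

/-- The set of `n`-dimensional simplices of `Δ`, i.e. the vertices of the dual graph. -/
def DualVertex : Type := {s : Finset (EuclideanSpace ℝ (Fin n)) // s ∈ Δ.faces ∧ s.card = n + 1}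

variable {Δ}

/-- The `n`-simplex `σ_v` as a subset of `ℝⁿ`. -/
def DualVertex.simplex (v : DualVertex Δ) : Set (EuclideanSpace ℝ (Fin n)) :=
  convexHull ℝ (v.1 : Set (EuclideanSpace ℝ (Fin n)))

/-- The polynomial `P` restricts to the same function as `F` on the `n`-simplex `σ_v`. -/
def AgreesOn (F : Δ.space → ℂ) (v : DualVertex Δ) (P : MvPolynomial (Fin n) ℂ) : Prop :=
  ∀ x : Δ.space, (x : EuclideanSpace ℝ (Fin n)) ∈ v.simplex → F x = evalReal x.1 P

/-- The restriction of `F` to each `n`-simplex is a polynomial of degree at most `d`. -/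
def IsPiecewisePolynomial (d : ℕ) (F : Δ.space → ℂ) : Prop :=
  ∀ v : DualVertex Δ, ∃ P : MvPolynomial (Fin n) ℂ, P.totalDegree ≤ d ∧ AgreesOn F v P

/-- `F` is continuously differentiable of order `r` as a function on the subspace `Δ` of `ℝⁿ`.
(`ContDiffOn ℝ r g Δ.space` depends only on the values of `g` on `Δ.space`.) -/
def IsContDiff (r : ℕ) (F : Δ.space → ℂ) : Prop :=
  ∃ g : EuclideanSpace ℝ (Fin n) → ℂ, ContDiffOn ℝ (r : ℕ∞) g Δ.space ∧ ∀ x : Δ.space, F x = g x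

variable (Δ)

/-- The space `S^r_d(Δ)` of (complex-valued) splines: functions on `Δ` of class `C^r` that restrict
to a polynomial of degree at most `d` on each `n`-simplex. -/
def splineSpace (r d : ℕ) : Submodule ℂ (Δ.space → ℂ) where
  carrier := {F | IsPiecewisePolynomial d F ∧ IsContDiff r F}
  add_mem' := by
    rintro F F' ⟨hF, g, hg, hFg⟩ ⟨hF', g', hg', hFg'⟩
    refine ⟨fun v => ?_, g + g', hg.add hg', fun x => by simp [hFg, hFg']⟩
    obtain ⟨P, hPd, hP⟩ := hF v
    obtain ⟨Q, hQd, hQ⟩ := hF' v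
    exact ⟨P + Q, (totalDegree_add P Q).trans (max_le hPd hQd),
      fun x hx => by simp [evalReal, hP x hx, hQ x hx]⟩
  zero_mem' := ⟨fun v => ⟨0, by simp, fun x _ => by simp [evalReal]⟩, 0, contDiffOn_const,
    fun x => by simp⟩
  smul_mem' := by
    rintro c F ⟨hF, g, hg, hFg⟩
    refine ⟨fun v => ?_, fun x => c * g x, contDiffOn_const.mul hg, fun x => by simp [hFg]⟩
    obtain ⟨P, hPd, hP⟩ := hF v
    exact ⟨C c * P, by rw [← smul_eq_C_mul]; exact (totalDegree_smul_le c P).trans hPd,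
      fun x hx => by simp [evalReal, hP x hx]⟩

open Classical in
/-- The dual graph `G_Δ`: its vertices are the `n`-simplices of `Δ`, and `uv` is an edge when
`σ_u ∩ σ_v` is an `(n-1)`-simplex, i.e. when `u` and `v` have exactly `n` common vertices. -/
def dualGraph : SimpleGraph (DualVertex Δ) where
  Adj u v := (u.1 ∩ v.1).card = n
  symm := ⟨fun u v h => by rwa [Finset.inter_comm]⟩
  loopless := ⟨fun u h => by
    rw [Finset.inter_self, u.2.2] at h
    omega⟩

/-- The dual edge-labeling `α_Δ`: the edge `uv` is labeled by the ideal generated by the affine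
linear forms that vanish on `σ_u ∩ σ_v`. Any two such nonzero forms are proportional, so this is the
principal ideal generated by any one of them (`dualLabel_eq_span_singleton`). -/
def dualLabel (e : (dualGraph Δ).edgeSet) : Ideal (MvPolynomial (Fin n) ℂ) :=
  Ideal.span {l | l.totalDegree ≤ 1 ∧
    ∀ x : EuclideanSpace ℝ (Fin n), (∀ w ∈ e.1, x ∈ w.simplex) → evalReal x l = 0}

/-- A polynomial of degree at most one is an affine form. -/
theorem eq_affine_form (l : MvPolynomial (Fin n) ℂ) (hl : l.totalDegree ≤ 1) :
    l = C (l.coeff 0) + ∑ i, C (l.coeff (Finsupp.single i 1)) * X i := by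
  classical
  ext m
  simp only [coeff_add, coeff_C, coeff_sum, coeff_C_mul, coeff_X, mul_ite, mul_one, mul_zero]
  by_cases h0 : m = 0
  · subst h0
    simp
  by_cases h1 : ∃ i, m = Finsupp.single i 1
  · obtain ⟨i, rfl⟩ := h1
    rw [if_neg (Ne.symm h0), Finset.sum_eq_single i]
    · simp
    · intro j _ hj
      rw [if_neg]
      rw [Finsupp.single_left_inj one_ne_zero]
      exact hj
    · simp
  · rw [if_neg (Ne.symm h0), Finset.sum_eq_zero]
    · rw [add_zero]
      by_contra hc
      have hm : m.degree ≤ 1 := (le_totalDegree (mem_support_iff.2 hc)).trans hl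
      obtain ⟨i, hi⟩ := Finsupp.ne_iff.1 h0
      have hle : Finsupp.single i 1 ≤ m :=
        Finsupp.single_le_iff.2 (Nat.one_le_iff_ne_zero.2 hi)
      have hadd := tsub_add_cancel_of_le hle
      rw [← hadd, map_add, Finsupp.degree_single] at hm
      have hz : m - Finsupp.single i 1 = 0 :=
        (Finsupp.degree_eq_zero_iff _).1 (by omega)
      exact h1 ⟨i, by rw [← hadd, hz, zero_add]⟩
    · intro i _
      rw [if_neg]
      exact fun h => h1 ⟨i, h.symm⟩

/-- An affine form that vanishes at the vertices of an `n`-simplex is zero. -/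
theorem eq_zero_of_vanishes (v : DualVertex Δ) (l : MvPolynomial (Fin n) ℂ)
    (hl : l.totalDegree ≤ 1) (h : ∀ x ∈ v.1, evalReal x l = 0) : l = 0 := by
  have hform := eq_affine_form l hl
  set c := l.coeff 0 with hc
  set a : Fin n → ℂ := fun i => l.coeff (Finsupp.single i 1) with ha
  let L : EuclideanSpace ℝ (Fin n) →ₗ[ℝ] ℂ :=
    ∑ i, ((EuclideanSpace.proj i : EuclideanSpace ℝ (Fin n) →L[ℝ] ℝ) :
      EuclideanSpace ℝ (Fin n) →ₗ[ℝ] ℝ).smulRight (a i)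
  let A : EuclideanSpace ℝ (Fin n) →ᵃ[ℝ] ℂ :=
    L.toAffineMap + AffineMap.const ℝ (EuclideanSpace ℝ (Fin n)) c
  have hA : ∀ x, A x = evalReal x l := by
    intro x
    rw [hform]
    simp [A, L, evalReal, add_comm, mul_comm, a]
  have hspan : affineSpan ℝ (v.1 : Set (EuclideanSpace ℝ (Fin n))) = ⊤ := by
    have hi := Δ.indep v.2.1
    have := hi.affineSpan_eq_top_iff_card_eq_finrank_add_one.2 (by simp [v.2.2])
    simpa using this
  have hzero : A = AffineMap.const ℝ (EuclideanSpace ℝ (Fin n)) 0 :=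
    AffineMap.ext_on hspan fun x hx => by rw [hA, h x hx]; simp
  have hz : ∀ x, c + L x = 0 := fun x => by
    have := congrArg (fun B => B x) hzero
    simpa [A, add_comm] using this
  have c0 : c = 0 := by simpa using hz 0
  have a0 : ∀ i, a i = 0 := fun i => by
    have := hz (EuclideanSpace.single i 1)
    simpa [c0, L, PiLp.single_apply, apply_ite Complex.ofReal] using this
  rw [hform, c0]
  simp only [a] at a0
  simp [a0]

/-- The label of an edge is the principal ideal generated by any nonzero affine form that vanishes
on the corresponding `(n-1)`-simplex. -/
theorem dualLabel_eq_span_singleton (e : (dualGraph Δ).edgeSet) (l : MvPolynomial (Fin n) ℂ)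
    (hl : l.totalDegree ≤ 1) (hl0 : l ≠ 0)
    (hv : ∀ x : EuclideanSpace ℝ (Fin n), (∀ w ∈ e.1, x ∈ w.simplex) → evalReal x l = 0) :
    dualLabel Δ e = Ideal.span {l} := by
  classical
  obtain ⟨e, he⟩ := e
  induction e with | _ u v => ?_
  have hcard : (u.1 ∩ v.1).card = n := he
  have hmem : ∀ x ∈ u.1, x ∈ v.1 → ∀ w ∈ s(u, v), x ∈ w.simplex := by
    intro x hx hx' w hw
    rcases Sym2.mem_iff.1 hw with rfl | rfl
    · exact subset_convexHull ℝ _ hx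
    · exact subset_convexHull ℝ _ hx'
  have hdiff : (u.1 \ v.1).card = 1 := by
    have := Finset.card_sdiff_add_card_inter u.1 v.1
    have := u.2.2
    omega
  obtain ⟨q, hq⟩ := Finset.card_eq_one.1 hdiff
  have hq' : ∀ x ∈ u.1, x ∉ v.1 → x = q := fun x hx hx' => by
    have : x ∈ u.1 \ v.1 := Finset.mem_sdiff.2 ⟨hx, hx'⟩
    simpa [hq] using this
  have hlq : evalReal q l ≠ 0 := by
    intro h0
    apply hl0
    apply eq_zero_of_vanishes Δ u l hl
    intro x hx
    by_cases hx' : x ∈ v.1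
    · exact hv x (hmem x hx hx')
    · rw [hq' x hx hx', h0]
  apply le_antisymm
  · refine Ideal.span_le.2 ?_
    rintro g ⟨hg, hgv⟩
    rw [SetLike.mem_coe, Ideal.mem_span_singleton]
    refine ⟨C (evalReal q g / evalReal q l), ?_⟩
    rw [← sub_eq_zero]
    apply eq_zero_of_vanishes Δ u
    · refine (totalDegree_sub _ _).trans (max_le hg ?_)
      rw [mul_comm, ← smul_eq_C_mul]
      exact (totalDegree_smul_le _ _).trans hl
    · intro x hx
      by_cases hx' : x ∈ v.1
      · have h1 := hgv x (hmem x hx hx')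
        have h2 := hv x (hmem x hx hx')
        simp only [evalReal] at h1 h2
        simp [evalReal, h1, h2]
      · rw [hq' x hx hx']
        simp only [evalReal] at hlq
        simp only [evalReal, map_sub, map_mul, eval_C]
        field_simp
        simp
  · rw [Ideal.span_singleton_le_iff_mem]
    exact Ideal.subset_span ⟨hl, hv⟩

variable {Δ}

open Classical in
/-- The dual map `F ↦ F*`: `F*(v)` is the polynomial that restricts to `F` on `σ_v` (it is unique,
since `σ_v` has interior points; the value is `0` if `F` is not polynomial on `σ_v`). -/
def dualMap (F : Δ.space → ℂ) (v : DualVertex Δ) : MvPolynomial (Fin n) ℂ :=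
  if h : ∃ P : MvPolynomial (Fin n) ℂ, AgreesOn F v P then h.choose else 0

/-! ### Passing to the quotient ring -/

/-- The ideal `I_m` of `ℂ[x₁, …, xₙ]` generated by the homogeneous elements of degree `m`. -/
def homogeneousIdeal (n m : ℕ) : Ideal (MvPolynomial (Fin n) ℂ) :=
  Ideal.span {f | f.IsHomogeneous m}

/-- The quotient ring `ℂ[x₁, …, xₙ] / I_m`. -/
abbrev TruncatedRing (n m : ℕ) : Type := MvPolynomial (Fin n) ℂ ⧸ homogeneousIdeal n m

/-- The quotient map `ℂ[x₁, …, xₙ] → ℂ[x₁, …, xₙ] / I_m`. -/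
abbrev truncate (n m : ℕ) : MvPolynomial (Fin n) ℂ →+* TruncatedRing n m :=
  Ideal.Quotient.mk (homogeneousIdeal n m)

variable (Δ)

/-- The ring of splines `R_{G_Δ, (ᾱ_Δ)^{r+1}}` over the quotient ring `ℂ[x₁, …, xₙ] / I_{d+1}`,
where `ᾱ_Δ` is `α_Δ` composed with the quotient map. -/
def dualSplineRing (r d : ℕ) :
    Subalgebra (TruncatedRing n (d + 1)) (DualVertex Δ → TruncatedRing n (d + 1)) :=
  splineRing (dualGraph Δ) (fun e => ((dualLabel Δ e).map (truncate n (d + 1))) ^ (r + 1))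

variable {Δ}

/-- `F̄*`: the labeling `F*` composed with the quotient map. -/
def reducedDual (d : ℕ) (F : Δ.space → ℂ) (v : DualVertex Δ) : TruncatedRing n (d + 1) :=
  truncate n (d + 1) (dualMap F v)

/-- The product `f · F` of a polynomial and a function on `Δ`. -/
def polyMul (f : MvPolynomial (Fin n) ℂ) (F : Δ.space → ℂ) : Δ.space → ℂ :=
  fun x => evalReal x.1 f * F x

end SplinePaper

end

noncomputable section

namespace SplinePaper

open MvPolynomial

/-! ### Truncation of polynomials -/

section Truncation

variable {n d : ℕ}

/-! The proof joins a smoothness criterion of Billera–Rose type to an algebraic fact about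
truncation.

Criterion (`isContDiff_iff_mem_dualLabel_pow`): a piecewise polynomial `F` is `C^r` iff `F*(u) -
F*(v)` lies in the `(r+1)`-st power of the label of every edge. Membership in that power means that
all derivatives of order at most `r` vanish on the common facet (`mem_dualLabel_pow_iff`). If `F` is
`C^r`, both polynomials have on the facet the derivatives of `F` within `Δ`. Conversely, let `σ_u`
and `σ_v` meet in any face `s`. A chain in the strongly connected link of `s` joins them through
`n`-simplices containing `s`, so the derivatives agree on all of `s` (`eq_of_forall_adj_eq`). They
then glue to a Taylor series on the finite closed cover of `Δ` by its `n`-simplices.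

Truncation: every class in `A` has exactly one representative of degree at most `d`. A power of a
homogeneous ideal contains a polynomial iff it contains its homogeneous components, so for degree at
most `d` nothing is lost modulo `I_{d+1}` (`truncate_mem_map_pow_iff`). The edge conditions over `A`
and over the polynomial ring therefore match. Lifting a spline over `A` to these representatives
gives surjectivity, and their uniqueness gives injectivity. Multiplicativity follows from the
uniqueness of `F*(v)`. -/

theorem homogeneousIdeal_eq_pow (n m : ℕ) :
    homogeneousIdeal n m = idealOfVars (Fin n) ℂ ^ m := by
  apply le_antisymm
  · refine Ideal.span_le.2 fun f hf => ?_
    rw [SetLike.mem_coe, mem_pow_idealOfVars_iff]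
    intro x hx
    rw [Finsupp.degree_apply]
    exact (IsHomogeneous.degree_eq_sum_deg_support hf hx).le
  · rw [pow_idealOfVars_eq_span]
    refine Ideal.span_mono ?_
    rintro _ ⟨x, hx, rfl⟩
    exact isHomogeneous_monomial 1 hx

/-- As a power of the ideal of the variables, `I_m` becomes a condition on coefficients, the form
used from here on. -/
theorem mem_homogeneousIdeal_iff {m : ℕ} {P : MvPolynomial (Fin n) ℂ} :
    P ∈ homogeneousIdeal n m ↔ ∀ x : Fin n →₀ ℕ, x.degree < m → P.coeff x = 0 := by
  rw [homogeneousIdeal_eq_pow, mem_pow_idealOfVars_iff']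

theorem eq_zero_of_mem_homogeneousIdeal {P : MvPolynomial (Fin n) ℂ} (hP : P.totalDegree ≤ d)
    (h : P ∈ homogeneousIdeal n (d + 1)) : P = 0 := by
  ext x
  rw [coeff_zero]
  by_contra hx
  have h1 : x.degree ≤ d := (le_totalDegree (mem_support_iff.2 hx)).trans hP
  exact hx (mem_homogeneousIdeal_iff.1 h x (by omega))

/-- Homogeneous components of degree above `d` lie in `I_{d+1}` and can be dropped from any
representative. -/
theorem exists_totalDegree_le_truncate_eq (a : TruncatedRing n (d + 1)) :
    ∃ P : MvPolynomial (Fin n) ℂ, P.totalDegree ≤ d ∧ truncate n (d + 1) P = a := by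
  obtain ⟨A, rfl⟩ := Ideal.Quotient.mk_surjective a
  refine ⟨∑ i ∈ Finset.range (d + 1), homogeneousComponent i A, ?_, ?_⟩
  · refine totalDegree_finsetSum_le fun i hi => ?_
    have := (homogeneousComponent_isHomogeneous i A).totalDegree_le
    have := Finset.mem_range.1 hi
    omega
  · rw [truncate, Ideal.Quotient.eq, mem_homogeneousIdeal_iff]
    intro x hx
    simp only [coeff_sub, coeff_sum, coeff_homogeneousComponent]
    rw [Finset.sum_ite_eq, if_pos (Finset.mem_range.2 hx), sub_self]

/-- Passing to the quotient by `I_{d+1}` does not affect the membership of polynomials of degree at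
most `d` in powers of a principal homogeneous ideal. -/
theorem truncate_mem_map_pow_iff {I : Ideal (MvPolynomial (Fin n) ℂ)} {k : ℕ}
    {f : MvPolynomial (Fin n) ℂ} (hf : f.IsHomogeneous k) (hI : I = Ideal.span {f})
    {Q : MvPolynomial (Fin n) ℂ} (hQ : Q.totalDegree ≤ d) (m : ℕ) :
    truncate n (d + 1) Q ∈ I.map (truncate n (d + 1)) ^ m ↔ Q ∈ I ^ m := by
  rw [← Ideal.map_pow]
  refine ⟨fun h => ?_, Ideal.mem_map_of_mem _⟩
  -- `a ∈ I ^ m` is congruent to `Q` modulo `I_{d+1}`, so the two share their components of degree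
  -- at most `d`. Those of `a` lie in the homogeneous ideal `I ^ m`, and `Q` has no others.
  obtain ⟨a, ha, hae⟩ :=
    (Ideal.mem_map_iff_of_surjective _ Ideal.Quotient.mk_surjective).1 h
  rw [Ideal.Quotient.eq, mem_homogeneousIdeal_iff] at hae
  let _ := MvPolynomial.gradedAlgebra (σ := Fin n) (R := ℂ)
  have hhom : (I ^ m).IsHomogeneous (homogeneousSubmodule (Fin n) ℂ) := by
    rw [hI, Ideal.span_singleton_pow]
    refine Ideal.homogeneous_span _ _ fun x hx => ?_
    rw [Set.mem_singleton_iff.1 hx]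
    exact ⟨k * m, hf.pow m⟩
  rw [mem_iff_homogeneousComponent_mem hhom]
  intro i
  by_cases hi : i ≤ d
  · have : homogeneousComponent i Q = homogeneousComponent i a := by
      ext x
      rw [coeff_homogeneousComponent, coeff_homogeneousComponent]
      split_ifs with hx
      · have := hae x (by omega)
        rw [coeff_sub, sub_eq_zero] at this
        exact this.symm
      · rfl
    rw [this]
    exact homogeneousComponent_mem_of_mem hhom ha i
  · rw [homogeneousComponent_eq_zero _ _ (by omega)]
    exact zero_mem _

end Truncation

/-! ### Polynomials as functions on `ℝⁿ` -/

section RealPoints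

variable {n : ℕ}

/-- A complex polynomial is determined by its values at the points of `ℝⁿ`. -/
theorem evalReal_ext {P Q : MvPolynomial (Fin n) ℂ}
    (h : ∀ x : EuclideanSpace ℝ (Fin n), evalReal x P = evalReal x Q) : P = Q := by
  -- The real points form a product of infinite subsets of `ℂ`, which is enough to determine a
  -- polynomial.
  refine funext_set (fun _ => Set.range ((↑) : ℝ → ℂ))
    (fun _ => Set.infinite_range_of_injective Complex.ofReal_injective) fun y hy => ?_
  choose z hz using fun i => hy i (Set.mem_univ i)
  have := h (WithLp.toLp 2 z)
  simpa [evalReal, hz] using this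

/-- The derivation of the polynomial ring along a vector of `ℝⁿ`. -/
def directionalDerivation (v : EuclideanSpace ℝ (Fin n)) :
    Derivation ℂ (MvPolynomial (Fin n) ℂ) (MvPolynomial (Fin n) ℂ) :=
  mkDerivation ℂ fun i => C (v i : ℂ)

theorem directionalDerivation_apply (v : EuclideanSpace ℝ (Fin n)) (Q : MvPolynomial (Fin n) ℂ) :
    directionalDerivation v Q = ∑ i, C (v i : ℂ) * pderiv i Q := by
  induction Q using MvPolynomial.induction_on with
  | C a => simp [directionalDerivation]
  | add p q hp hq => simp [hp, hq, mul_add, Finset.sum_add_distrib]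
  | mul_X p i hp =>
    rw [Derivation.leibniz, hp]
    simp only [directionalDerivation, mkDerivation_X, Derivation.leibniz, pderiv_X, smul_eq_mul,
      mul_add, Finset.sum_add_distrib, Pi.single_apply]
    simp [Finset.mul_sum, mul_comm, mul_left_comm]

/-- The real derivative of a polynomial at a point of `ℝⁿ`. -/
def evalDeriv (Q : MvPolynomial (Fin n) ℂ) (x : EuclideanSpace ℝ (Fin n)) :
    EuclideanSpace ℝ (Fin n) →L[ℝ] ℂ :=
  ∑ i, (EuclideanSpace.proj i : EuclideanSpace ℝ (Fin n) →L[ℝ] ℝ).smulRight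
    (evalReal x (pderiv i Q))

theorem evalDeriv_apply (Q : MvPolynomial (Fin n) ℂ) (x v : EuclideanSpace ℝ (Fin n)) :
    evalDeriv Q x v = evalReal x (directionalDerivation v Q) := by
  rw [directionalDerivation_apply]
  simp [evalDeriv, evalReal]

theorem contDiff_evalReal (Q : MvPolynomial (Fin n) ℂ) {m : WithTop ℕ∞} :
    ContDiff ℝ m fun x : EuclideanSpace ℝ (Fin n) => evalReal x Q := by
  induction Q using MvPolynomial.induction_on with
  | C a => simpa [evalReal] using contDiff_const
  | add p q hp hq => simpa [evalReal] using hp.add hq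
  | mul_X p i hp =>
    have : ContDiff ℝ m fun x : EuclideanSpace ℝ (Fin n) => (x i : ℂ) :=
      (Complex.ofRealCLM.comp
        (EuclideanSpace.proj i : EuclideanSpace ℝ (Fin n) →L[ℝ] ℝ)).contDiff
    simpa [evalReal] using hp.mul this

theorem hasFDerivAt_evalReal (Q : MvPolynomial (Fin n) ℂ) (x : EuclideanSpace ℝ (Fin n)) :
    HasFDerivAt (fun y => evalReal y Q) (evalDeriv Q x) x := by
  induction Q using MvPolynomial.induction_on with
  | C a => simpa [evalReal, evalDeriv] using hasFDerivAt_const a x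
  | add p q hp hq =>
    have : evalDeriv (p + q) x = evalDeriv p x + evalDeriv q x := by
      ext v; simp [evalDeriv_apply, evalReal]
    have hfun : (fun y => evalReal y (p + q)) =
        (fun y => evalReal y p) + fun y => evalReal y q := by
      ext y; simp [evalReal]
    rw [this, hfun]
    exact hp.add hq
  | mul_X p i hp =>
    have h1 : HasFDerivAt (fun y : EuclideanSpace ℝ (Fin n) => (y i : ℂ))
        (Complex.ofRealCLM.comp (EuclideanSpace.proj i : EuclideanSpace ℝ (Fin n) →L[ℝ] ℝ)) x :=
      (Complex.ofRealCLM.comp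
        (EuclideanSpace.proj i : EuclideanSpace ℝ (Fin n) →L[ℝ] ℝ)).hasFDerivAt
    have h2 := hp.mul h1
    have : (fun y => evalReal y (p * X i)) = fun y => evalReal y p * (y i : ℂ) := by
      ext y; simp [evalReal]
    rw [this]
    refine h2.congr_fderiv ?_
    ext v
    simp [evalDeriv_apply, evalReal, directionalDerivation]

theorem fderiv_evalReal (Q : MvPolynomial (Fin n) ℂ) :
    fderiv ℝ (fun y : EuclideanSpace ℝ (Fin n) => evalReal y Q) = evalDeriv Q :=
  funext fun x => (hasFDerivAt_evalReal Q x).fderiv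

/-- A polynomial that vanishes on the convex hull of finitely many points vanishes on their affine
span. -/
theorem evalReal_eq_zero_of_mem_affineSpan {W : Finset (EuclideanSpace ℝ (Fin n))}
    {Q : MvPolynomial (Fin n) ℂ}
    (h : ∀ x ∈ convexHull ℝ (W : Set (EuclideanSpace ℝ (Fin n))), evalReal x Q = 0)
    {z : EuclideanSpace ℝ (Fin n)}
    (hz : z ∈ affineSpan ℝ (W : Set (EuclideanSpace ℝ (Fin n)))) : evalReal z Q = 0 := by
  have hz' : z ∈ affineSpan ℝ (Set.range ((↑) : W → EuclideanSpace ℝ (Fin n))) := by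
    simpa using hz
  obtain ⟨w, hw1, hwz⟩ := eq_affineCombination_of_mem_affineSpan_of_fintype hz'
  rw [Finset.affineCombination_eq_linear_combination _ _ _ hw1] at hwz
  have hne : W.Nonempty := by
    rw [Finset.nonempty_iff_ne_empty]
    rintro rfl
    rw [Finset.coe_empty, AffineSubspace.span_empty] at hz
    exact AffineSubspace.notMem_bot ℝ _ z hz
  have hc : 0 < (W.card : ℝ) := by exact_mod_cast hne.card_pos
  -- `b` is the barycentre of `W`, and `φ` restricts polynomials to the line `b + t(z - b)`. For
  -- small `t > 0` the weights along this line stay positive, so it runs inside the hull. Hence `φ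
  -- Q` has infinitely many roots and vanishes; `t = 1` gives the value at `z`.
  set b : EuclideanSpace ℝ (Fin n) := ∑ i : W, (W.card : ℝ)⁻¹ • (i : EuclideanSpace ℝ (Fin n))
    with hb
  let φ : MvPolynomial (Fin n) ℂ →ₐ[ℂ] Polynomial ℂ := MvPolynomial.aeval
    (fun j => Polynomial.C (b j : ℂ) + Polynomial.X * Polynomial.C ((z j - b j : ℝ) : ℂ))
  have hp : ∀ (P : MvPolynomial (Fin n) ℂ) (t : ℝ),
      (φ P).eval (t : ℂ) = evalReal (b + t • (z - b)) P := by
    intro P t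
    induction P using MvPolynomial.induction_on with
    | C a => simp [φ, evalReal]
    | add p q hp hq => simp only [map_add, Polynomial.eval_add, hp, hq, evalReal]
    | mul_X p i hp =>
      rw [map_mul, Polynomial.eval_mul, hp]
      simp [φ, evalReal]
  have hmem : ∀ᶠ t : ℝ in nhdsWithin 0 (Set.Ioi 0),
      b + t • (z - b) ∈ convexHull ℝ (W : Set (EuclideanSpace ℝ (Fin n))) := by
    have hpos : ∀ i : W, ∀ᶠ t : ℝ in nhds 0, 0 < (W.card : ℝ)⁻¹ + t * (w i - (W.card : ℝ)⁻¹) := by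
      intro i
      have hcont : Continuous fun t : ℝ => (W.card : ℝ)⁻¹ + t * (w i - (W.card : ℝ)⁻¹) := by
        fun_prop
      refine hcont.continuousAt.eventually_const_lt ?_
      simpa using hc
    filter_upwards [(Filter.eventually_all.2 hpos).filter_mono nhdsWithin_le_nhds] with t ht
    have : b + t • (z - b) =
        ∑ i : W, ((W.card : ℝ)⁻¹ + t * (w i - (W.card : ℝ)⁻¹)) • (i : EuclideanSpace ℝ (Fin n)) := by
      rw [hwz, hb, ← Finset.sum_sub_distrib, Finset.smul_sum, ← Finset.sum_add_distrib]
      refine Finset.sum_congr rfl fun i _ => ?_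
      module
    rw [this]
    refine (convex_convexHull ℝ _).sum_mem (fun i _ => (ht i).le) ?_
      fun i _ => subset_convexHull ℝ _ i.2
    rw [Finset.sum_add_distrib, ← Finset.mul_sum, Finset.sum_sub_distrib, hw1]
    simp [hc.ne']
  have hp0 : φ Q = 0 := by
    apply Polynomial.eq_zero_of_infinite_isRoot
    obtain ⟨ε, hε, hsub⟩ := mem_nhdsGT_iff_exists_Ioo_subset.1 hmem
    refine ((Set.Ioo_infinite hε).image Complex.ofReal_injective.injOn).mono ?_
    rintro _ ⟨t, ht, rfl⟩
    exact (hp Q t).trans (h _ (hsub ht))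
  have := hp Q 1
  rw [hp0] at this
  simpa using this.symm

end RealPoints

/-! ### Divisibility by powers of an affine form and vanishing of derivatives -/

section Jets

variable {n : ℕ}

theorem iteratedFDeriv_sum_eq_zero {ι E F : Type*} [NormedAddCommGroup E] [NormedSpace ℝ E]
    [NormedAddCommGroup F] [NormedSpace ℝ F] {s : Finset ι} {f : ι → E → F} {k : ℕ} {x : E}
    (hf : ∀ i ∈ s, ContDiff ℝ k (f i)) (h : ∀ i ∈ s, iteratedFDeriv ℝ k (f i) x = 0) :
    iteratedFDeriv ℝ k (fun y => ∑ i ∈ s, f i y) x = 0 := by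
  rw [iteratedFDeriv_sum hf, Finset.sum_apply]
  exact Finset.sum_eq_zero h

/-- The derivatives of order `k` of a multiple of `l ^ (k + 1)` vanish at the zeros
of `l`. -/
theorem iteratedFDeriv_evalReal_eq_zero_of_pow_dvd {l : MvPolynomial (Fin n) ℂ}
    {x : EuclideanSpace ℝ (Fin n)} (hx : evalReal x l = 0) (k : ℕ) :
    ∀ {Q : MvPolynomial (Fin n) ℂ}, l ^ (k + 1) ∣ Q →
      iteratedFDeriv ℝ k (fun y => evalReal y Q) x = 0 := by
  induction k with
  | zero =>
    rintro _ ⟨c, rfl⟩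
    ext m
    have : evalReal x (l ^ (0 + 1) * c) = evalReal x l * evalReal x c := by simp [evalReal]
    rw [iteratedFDeriv_zero_apply, this, hx, zero_mul]
    rfl
  | succ k ih =>
    intro Q hQ
    -- The derivative of order `k + 1` and the `k`-th derivative of `fderiv` live in different
    -- spaces, so vanishing is transferred through their norms.
    rw [← norm_eq_zero, ← norm_iteratedFDeriv_fderiv, norm_eq_zero, fderiv_evalReal]
    let T : Fin n → ℂ →L[ℝ] (EuclideanSpace ℝ (Fin n) →L[ℝ] ℂ) := fun i =>
      ContinuousLinearMap.smulRightL ℝ (EuclideanSpace ℝ (Fin n)) ℂ (EuclideanSpace.proj i)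
    have hT : evalDeriv Q =
        fun y => ∑ i, (T i ∘ fun y => evalReal y (pderiv i Q)) y := by
      ext y v
      simp [evalDeriv, T]
    rw [hT]
    refine iteratedFDeriv_sum_eq_zero (fun i _ => (T i).contDiff.comp (contDiff_evalReal _))
      fun i _ => ?_
    rw [ContinuousLinearMap.iteratedFDeriv_comp_left (T i) (contDiff_evalReal _).contDiffAt le_rfl,
      ih]
    · ext; simp
    · obtain ⟨c, rfl⟩ := hQ
      -- The cofactor comes from the product rule applied to `l ^ (k + 2) * c`: differentiating
      -- costs one factor `l`.
      refine ⟨((k + 1 + 1 : ℕ) : MvPolynomial (Fin n) ℂ) * pderiv i l * c + l * pderiv i c, ?_⟩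
      rw [pderiv_mul, pderiv_pow]
      simp only [Nat.add_sub_cancel]
      ring

/-- If every polynomial that vanishes on `S` is divisible by `l`, then a polynomial all of whose
derivatives of order at most `r` vanish on `S` is divisible by `l ^ (r + 1)`. -/
theorem pow_dvd_of_iteratedFDeriv_evalReal_eq_zero {l : MvPolynomial (Fin n) ℂ}
    {v : EuclideanSpace ℝ (Fin n)} (hl : directionalDerivation v l = 1)
    {S : Set (EuclideanSpace ℝ (Fin n))}
    (hS : ∀ Q : MvPolynomial (Fin n) ℂ, (∀ x ∈ S, evalReal x Q = 0) → l ∣ Q) (r : ℕ) :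
    ∀ Q : MvPolynomial (Fin n) ℂ,
      (∀ k ≤ r, ∀ x ∈ S, iteratedFDeriv ℝ k (fun y => evalReal y Q) x = 0) → l ^ (r + 1) ∣ Q := by
  have hl0 : l ≠ 0 := by
    rintro rfl
    simp at hl
  induction r with
  | zero =>
    intro Q h
    rw [zero_add, pow_one]
    refine hS Q fun x hx => ?_
    have := congrArg (fun m => m 0) (h 0 le_rfl x hx)
    simpa [iteratedFDeriv_zero_apply] using this
  | succ r ih =>
    intro Q h
    obtain ⟨R, hR⟩ := ih Q fun k hk => h k (by omega)
    -- With `D` the derivation along `v`, `Q = l ^ (r + 1) * R` and `D l = 1` give `D Q = (r + 1) l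
    -- ^ r R + l ^ (r + 1) D R`. Induction also applies to `D Q`, whose derivatives up to order `r`
    -- vanish on `S`. Thus `l` divides `(r + 1) R`, and `r + 1` is invertible in `ℂ`.
    have hD : l ^ (r + 1) ∣ directionalDerivation v Q := by
      refine ih _ fun k hk x hx => ?_
      have h0 := h (k + 1) (by omega) x hx
      rw [← norm_eq_zero, ← norm_iteratedFDeriv_fderiv, norm_eq_zero, fderiv_evalReal] at h0
      have hc : ContDiff ℝ k (evalDeriv Q) := by
        rw [← fderiv_evalReal]
        exact (contDiff_evalReal Q (m := k + 1)).fderiv_right le_rfl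
      have heq : (fun y => evalReal y (directionalDerivation v Q)) =
          ContinuousLinearMap.apply ℝ ℂ v ∘ evalDeriv Q := by
        ext y
        simp [evalDeriv_apply]
      rw [heq, ContinuousLinearMap.iteratedFDeriv_comp_left _ hc.contDiffAt le_rfl, h0]
      ext; simp
    have hdvd : l ^ (r + 1) ∣ l ^ r * (C ((r + 1 : ℕ) : ℂ) * R) := by
      have heq : l ^ r * (C ((r + 1 : ℕ) : ℂ) * R) =
          directionalDerivation v Q - l ^ (r + 1) * directionalDerivation v R := by
        rw [hR, Derivation.leibniz, Derivation.leibniz_pow, hl]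
        simp only [smul_eq_mul, nsmul_eq_mul, Nat.add_sub_cancel, map_natCast]
        ring
      rw [heq]
      exact dvd_sub hD (dvd_mul_right _ _)
    rw [pow_succ, mul_dvd_mul_iff_left (pow_ne_zero r hl0)] at hdvd
    have hu : IsUnit (C ((r + 1 : ℕ) : ℂ) : MvPolynomial (Fin n) ℂ) :=
      (IsUnit.mk0 _ (Nat.cast_ne_zero.2 r.succ_ne_zero)).map C
    obtain ⟨c, rfl⟩ := hu.dvd_mul_left.1 hdvd
    exact ⟨c, by rw [hR]; ring⟩

end Jets

/-! ### The affine form of an edge of the dual graph -/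

section EdgeForm

variable {n : ℕ} {Δ : Geometry.SimplicialComplex ℝ (EuclideanSpace ℝ (Fin n))}

theorem DualVertex.affineSpan_eq_top (v : DualVertex Δ) :
    affineSpan ℝ (v.1 : Set (EuclideanSpace ℝ (Fin n))) = ⊤ := by
  have := (Δ.indep v.2.1).affineSpan_eq_top_iff_card_eq_finrank_add_one.2 (by simp [v.2.2])
  simpa using this

/-- The real affine function that is `1` at one vertex of an `n`-simplex and `0` at the others. -/
theorem DualVertex.exists_barycentric (u : DualVertex Δ) {q : EuclideanSpace ℝ (Fin n)}
    (hq : q ∈ u.1) :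
    ∃ f : EuclideanSpace ℝ (Fin n) →ᵃ[ℝ] ℝ, f q = 1 ∧ ∀ p ∈ u.1, p ≠ q → f p = 0 := by
  let B : AffineBasis u.1 ℝ (EuclideanSpace ℝ (Fin n)) :=
    ⟨(↑), Δ.indep u.2.1, by simpa using u.affineSpan_eq_top⟩
  refine ⟨B.coord ⟨q, hq⟩, B.coord_apply_eq ⟨q, hq⟩, fun p hp hpq => ?_⟩
  exact B.coord_apply_ne (i := ⟨q, hq⟩) (j := ⟨p, hp⟩) fun h => hpq (congrArg Subtype.val h).symm

/-- A real affine function as a polynomial. -/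
def affineForm (f : EuclideanSpace ℝ (Fin n) →ᵃ[ℝ] ℝ) : MvPolynomial (Fin n) ℂ :=
  C (f 0 : ℂ) + ∑ i, C (f.linear (EuclideanSpace.single i 1) : ℂ) * X i

theorem linear_eq_sum (f : EuclideanSpace ℝ (Fin n) →ₗ[ℝ] ℝ) (x : EuclideanSpace ℝ (Fin n)) :
    f x = ∑ i, f (EuclideanSpace.single i 1) * x i := by
  conv_lhs => rw [← (EuclideanSpace.basisFun (Fin n) ℝ).sum_repr x]
  simp [mul_comm]

theorem evalReal_affineForm (f : EuclideanSpace ℝ (Fin n) →ᵃ[ℝ] ℝ)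
    (x : EuclideanSpace ℝ (Fin n)) : evalReal x (affineForm f) = (f x : ℂ) := by
  have h : f x = f.linear x + f 0 := by
    simpa using f.map_vadd 0 x
  rw [h, linear_eq_sum]
  simp [affineForm, evalReal, add_comm]

theorem directionalDerivation_affineForm (f : EuclideanSpace ℝ (Fin n) →ᵃ[ℝ] ℝ)
    (v : EuclideanSpace ℝ (Fin n)) :
    directionalDerivation v (affineForm f) = C (f.linear v : ℂ) := by
  rw [linear_eq_sum]
  simp [affineForm, directionalDerivation]

theorem totalDegree_affineForm_le (f : EuclideanSpace ℝ (Fin n) →ᵃ[ℝ] ℝ) :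
    (affineForm f).totalDegree ≤ 1 := by
  refine (totalDegree_add _ _).trans (max_le (by simp) (totalDegree_finsetSum_le fun i _ => ?_))
  rw [← smul_eq_C_mul]
  exact (totalDegree_smul_le _ _).trans (by simp)

/-- If `v` is a vector with `f(v) = 1` for the linear part of `f`, a polynomial that vanishes on the
zero set of `f` is divisible by `f`. -/
theorem affineForm_dvd {f : EuclideanSpace ℝ (Fin n) →ᵃ[ℝ] ℝ} {v : EuclideanSpace ℝ (Fin n)}
    {Q : MvPolynomial (Fin n) ℂ}
    (h : ∀ x : EuclideanSpace ℝ (Fin n), evalReal (x - f x • v) Q = 0) : affineForm f ∣ Q := by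
  -- `φ` substitutes `x - f(x) v` for `x`. It kills `Q` by assumption and is the identity modulo
  -- `f`, hence `Q` is zero modulo `f`.
  let φ : MvPolynomial (Fin n) ℂ →ₐ[ℂ] MvPolynomial (Fin n) ℂ :=
    aeval fun j => X j - affineForm f * C (v j : ℂ)
  have hφ : ∀ (P : MvPolynomial (Fin n) ℂ) (x : EuclideanSpace ℝ (Fin n)),
      evalReal x (φ P) = evalReal (x - f x • v) P := by
    intro P x
    induction P using MvPolynomial.induction_on with
    | C a => simp [φ, evalReal]
    | add p q hp hq => simp only [evalReal, map_add] at hp hq ⊢; rw [hp, hq]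
    | mul_X p i hp =>
      have := evalReal_affineForm f x
      simp only [evalReal] at hp this ⊢
      rw [map_mul, map_mul, map_mul, hp]
      simp [φ, this]
  have h0 : φ Q = 0 := evalReal_ext fun x => by rw [hφ, h]; simp [evalReal]
  rw [← Ideal.mem_span_singleton, ← Ideal.Quotient.eq_zero_iff_mem]
  have hcomp : (Ideal.Quotient.mkₐ ℂ (Ideal.span {affineForm f})).comp φ =
      Ideal.Quotient.mkₐ ℂ (Ideal.span {affineForm f}) := by
    refine MvPolynomial.algHom_ext fun i => ?_
    have : Ideal.Quotient.mk (Ideal.span {affineForm f}) (affineForm f) = 0 :=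
      Ideal.Quotient.eq_zero_iff_mem.2 (Ideal.mem_span_singleton_self _)
    simp [φ, this]
  have := congrArg (fun g => g Q) hcomp
  simpa [h0] using this.symm

open Classical in
-- Only `n = 0` needs an argument: `ℝ⁰` is one point, so two `0`-simplices share their vertex and
-- the dual graph has no edge.
theorem inter_nonempty_of_adj {u v : DualVertex Δ} (h : (dualGraph Δ).Adj u v) :
    (u.1 ∩ v.1).Nonempty := by
  have hcard : (u.1 ∩ v.1).card = n := h
  by_contra hne
  rw [Finset.not_nonempty_iff_eq_empty] at hne
  rw [hne, Finset.card_empty] at hcard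
  subst hcard
  obtain ⟨p, hp⟩ := Finset.card_pos.1 (by rw [u.2.2]; omega : 0 < u.1.card)
  obtain ⟨q, hq⟩ := Finset.card_pos.1 (by rw [v.2.2]; omega : 0 < v.1.card)
  have : p ∈ u.1 ∩ v.1 := Finset.mem_inter.2 ⟨hp, Subsingleton.elim q p ▸ hq⟩
  simp [hne] at this

open Classical in
-- The form is the barycentric coordinate of the vertex `q` of `u` opposite the common facet. The
-- vector runs from a common vertex `b` to `q`, so the coordinate grows by `1` along it.
theorem exists_edge_form {u v : DualVertex Δ} (h : (dualGraph Δ).Adj u v) :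
    ∃ (l : MvPolynomial (Fin n) ℂ) (w : EuclideanSpace ℝ (Fin n)),
      l.totalDegree ≤ 1 ∧ directionalDerivation w l = 1 ∧
      (∀ x ∈ u.simplex ∩ v.simplex, evalReal x l = 0) ∧
      ∀ Q : MvPolynomial (Fin n) ℂ, (∀ x ∈ u.simplex ∩ v.simplex, evalReal x Q = 0) → l ∣ Q := by
  have hcard : (u.1 ∩ v.1).card = n := h
  obtain ⟨b, hb⟩ := inter_nonempty_of_adj h
  obtain ⟨q, hq⟩ : ∃ q, u.1 \ v.1 = {q} := by
    rw [← Finset.card_eq_one]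
    have := Finset.card_sdiff_add_card_inter u.1 v.1
    have := u.2.2
    omega
  have hqm : q ∈ u.1 \ v.1 := by simp [hq]
  have hq' : ∀ x ∈ u.1, x ≠ q → x ∈ v.1 := fun x hx hxq => by
    by_contra hx'
    have : x ∈ u.1 \ v.1 := Finset.mem_sdiff.2 ⟨hx, hx'⟩
    exact hxq (by simpa [hq] using this)
  obtain ⟨f, hfq, hf⟩ := u.exists_barycentric (Finset.mem_sdiff.1 hqm).1
  have hf0 : ∀ p ∈ u.1 ∩ v.1, f p = 0 := fun p hp =>
    hf p (Finset.mem_inter.1 hp).1 fun hpq =>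
      (Finset.mem_sdiff.1 hqm).2 (hpq ▸ (Finset.mem_inter.1 hp).2)
  refine ⟨affineForm f, q - b, totalDegree_affineForm_le f, ?_, ?_, ?_⟩
  · have : f.linear (q - b) = 1 := by
      have := f.linearMap_vsub q b
      simpa [hfq, hf0 b hb] using this
    rw [directionalDerivation_affineForm, this]
    simp
  · intro x hx
    have hx' := Δ.inter_subset_convexHull u.2.1 v.2.1 hx
    have hsub : convexHull ℝ ((u.1 : Set (EuclideanSpace ℝ (Fin n))) ∩ v.1) ⊆ f ⁻¹' {0} :=
      convexHull_min (fun p hp => hf0 p (Finset.mem_inter.2 hp))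
        ((convex_singleton 0).affine_preimage f)
    rw [evalReal_affineForm, hsub hx']
    simp
  · intro Q hQ
    refine affineForm_dvd (v := q - b) fun x => ?_
    refine evalReal_eq_zero_of_mem_affineSpan (W := u.1 ∩ v.1) (fun y hy => hQ y ⟨?_, ?_⟩) ?_
    · exact convexHull_mono (by simp) hy
    · exact convexHull_mono (by simp) hy
    -- `T` projects `ℝⁿ` to the affine span of the common facet: it sends `q` to `b` and fixes the
    -- other vertices of `u`, and these vertices span `ℝⁿ`.
    · let T : EuclideanSpace ℝ (Fin n) →ᵃ[ℝ] EuclideanSpace ℝ (Fin n) :=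
        AffineMap.id ℝ _ - (LinearMap.toSpanSingleton ℝ _ (q - b)).toAffineMap.comp f
      have hT : ∀ y, T y = y - f y • (q - b) := fun y => by simp [T]
      have hle : affineSpan ℝ (u.1 : Set (EuclideanSpace ℝ (Fin n))) ≤
          (affineSpan ℝ ((u.1 ∩ v.1 : Finset _) : Set (EuclideanSpace ℝ (Fin n)))).comap T := by
        rw [affineSpan_le]
        intro p hp
        rw [SetLike.mem_coe, AffineSubspace.mem_comap, hT]
        by_cases hpq : p = q
        · rw [hpq, hfq, one_smul, sub_sub_cancel]
          exact subset_affineSpan ℝ _ hb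
        · rw [hf p hp hpq, zero_smul, sub_zero]
          exact subset_affineSpan ℝ _ (Finset.mem_inter.2 ⟨hp, hq' p hp hpq⟩)
      rw [u.affineSpan_eq_top] at hle
      have := hle (AffineSubspace.mem_top ℝ _ x)
      rwa [AffineSubspace.mem_comap, hT] at this

/-- A polynomial lies in the `(r + 1)`-st power of the label of an edge exactly when its derivatives
of order at most `r` vanish on the corresponding `(n-1)`-simplex. -/
theorem mem_dualLabel_pow_iff {u v : DualVertex Δ} (h : (dualGraph Δ).Adj u v) (r : ℕ)
    (Q : MvPolynomial (Fin n) ℂ) :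
    Q ∈ dualLabel Δ ⟨s(u, v), h⟩ ^ (r + 1) ↔
      ∀ k ≤ r, ∀ x ∈ u.simplex ∩ v.simplex,
        iteratedFDeriv ℝ k (fun y => evalReal y Q) x = 0 := by
  obtain ⟨l, w, hdeg, hl, hl0, hdvd⟩ := exists_edge_form h
  have hspan : dualLabel Δ ⟨s(u, v), h⟩ = Ideal.span {l} := by
    refine dualLabel_eq_span_singleton Δ _ l hdeg ?_ fun x hx => hl0 x ⟨?_, ?_⟩
    · rintro rfl
      simp at hl
    · exact hx u (Sym2.mem_mk_left u v)
    · exact hx v (Sym2.mem_mk_right u v)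
  rw [hspan, Ideal.span_singleton_pow, Ideal.mem_span_singleton]
  constructor
  · intro hQ k hk x hx
    exact iteratedFDeriv_evalReal_eq_zero_of_pow_dvd (hl0 x hx) k
      ((pow_dvd_pow l (by omega)).trans hQ)
  · exact pow_dvd_of_iteratedFDeriv_evalReal_eq_zero hl hdvd r Q

end EdgeForm

variable {n : ℕ} {Δ : Geometry.SimplicialComplex ℝ (EuclideanSpace ℝ (Fin n))}

/-! ### Combinatorics of strongly connected complexes -/

section Combinatorics

/-- The size `m` in strong connectedness is forced to be `n + 1`: some `n`-simplex lies in a simplex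
with `m` vertices, and none has more than `n + 1`. -/
theorem exists_dualVertex_superset
    (hdim : IsOfDimension Δ.toPreAbstractSimplicialComplex n)
    (hconn : IsStronglyConnected Δ.toPreAbstractSimplicialComplex)
    {s : Finset (EuclideanSpace ℝ (Fin n))} (hs : s ∈ Δ.faces) :
    ∃ v : DualVertex Δ, s ⊆ v.1 := by
  obtain ⟨m, hpure, -⟩ := hconn
  obtain ⟨⟨t, ht, htc⟩, hle⟩ := hdim
  obtain ⟨t', ht', htt', htc'⟩ := hpure t ht
  have h1 := Finset.card_le_card htt'
  have h2 := hle t' ht'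
  obtain ⟨w, hw, hsw, hwc⟩ := hpure s hs
  exact ⟨⟨w, hw, by omega⟩, hsw⟩

theorem DualVertex.simplex_subset_space (v : DualVertex Δ) : v.simplex ⊆ Δ.space :=
  Δ.convexHull_subset_space v.2.1

theorem space_eq_iUnion_simplex
    (hdim : IsOfDimension Δ.toPreAbstractSimplicialComplex n)
    (hconn : IsStronglyConnected Δ.toPreAbstractSimplicialComplex) :
    Δ.space = ⋃ v : DualVertex Δ, v.simplex := by
  apply subset_antisymm
  · intro x hx
    obtain ⟨s, hs, hxs⟩ := Geometry.SimplicialComplex.mem_space_iff.1 hx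
    obtain ⟨v, hv⟩ := exists_dualVertex_superset hdim hconn hs
    exact Set.mem_iUnion.2 ⟨v, convexHull_mono (Finset.coe_subset.2 hv) hxs⟩
  · exact Set.iUnion_subset fun v => v.simplex_subset_space

theorem exists_mem_simplex
    (hdim : IsOfDimension Δ.toPreAbstractSimplicialComplex n)
    (hconn : IsStronglyConnected Δ.toPreAbstractSimplicialComplex)
    {x : EuclideanSpace ℝ (Fin n)} (hx : x ∈ Δ.space) : ∃ v : DualVertex Δ, x ∈ v.simplex :=
  Set.mem_iUnion.1 (space_eq_iUnion_simplex hdim hconn ▸ hx)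

open Classical in
/-- If the link of `s` is strongly connected, a function on the top-dimensional simplices that takes
the same value at adjacent ones that contain `s` is constant on those that contain `s`. -/
theorem eq_of_forall_adj_eq {ι β : Type*} {K : PreAbstractSimplicialComplex ι} {n : ℕ}
    (hdim : ∀ t ∈ K.faces, t.card ≤ n + 1) {s : Finset ι}
    (hlink : IsStronglyConnected (link K s))
    {J : {t : Finset ι // t ∈ K.faces ∧ t.card = n + 1} → β}
    (hJ : ∀ u v, s ⊆ u.1 → s ⊆ v.1 → (u.1 ∩ v.1).card = n → J u = J v)
    {u v : {t : Finset ι // t ∈ K.faces ∧ t.card = n + 1}} (hu : s ⊆ u.1) (hv : s ⊆ v.1) :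
    J u = J v := by
  -- Here `s` is itself top-dimensional and equals both `u` and `v`. This case is separate because
  -- `u \ s` would be empty, hence not a simplex of the link.
  by_cases hsc : s.card = n + 1
  · have h1 := Finset.eq_of_subset_of_card_le hu (by rw [u.2.2, hsc])
    have h2 := Finset.eq_of_subset_of_card_le hv (by rw [v.2.2, hsc])
    rw [Subtype.ext (h1.symm.trans h2)]
  have hsub : ∀ w : {t : Finset ι // t ∈ K.faces ∧ t.card = n + 1}, s ⊆ w.1 →
      w.1 \ s ∈ (link K s).faces ∧
        (w.1 \ s).card + s.card = n + 1 := by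
    intro w hw
    have hc : (w.1 \ s).card + s.card = n + 1 := by
      rw [Finset.card_sdiff_add_card_eq_card hw, w.2.2]
    refine ⟨⟨?_, Finset.disjoint_sdiff, ?_⟩, hc⟩
    · rw [← Finset.card_pos]
      have := Finset.card_le_card hw
      have := w.2.2
      omega
    · rw [Finset.union_sdiff_of_subset hw]
      exact w.2.1
  obtain ⟨m, hpure, hchain⟩ := hlink
  obtain ⟨hul, huc⟩ := hsub u hu
  obtain ⟨hvl, hvc⟩ := hsub v hv
  have hm : m + s.card = n + 1 := by
    obtain ⟨t, ⟨-, hdisj, ht⟩, hut, htc⟩ := hpure _ hul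
    have h1 := Finset.card_le_card hut
    have h2 := hdim _ ht
    rw [Finset.card_union_of_disjoint hdisj] at h2
    omega
  -- A chain in the link lifts to `Δ` by adjoining `s`: consecutive members then share `|s| + (m -
  -- 1) = n` vertices.
  have key : ∀ c, Relation.ReflTransGen
      (fun a b : Finset ι =>
        b ∈ (link K s).faces ∧ b.card = m ∧
          (a ∩ b).card + 1 = m) (u.1 \ s) c →
      ∃ w : {t : Finset ι // t ∈ K.faces ∧ t.card = n + 1}, s ⊆ w.1 ∧ w.1 \ s = c ∧ J u = J w := by
    intro c hc
    induction hc with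
    | refl => exact ⟨u, hu, rfl, rfl⟩
    | @tail a b _ hab ih =>
      obtain ⟨w, hsw, rfl, hJw⟩ := ih
      obtain ⟨⟨-, hdisj, hb⟩, hbc, hcard⟩ := hab
      let w' : {t : Finset ι // t ∈ K.faces ∧ t.card = n + 1} :=
        ⟨s ∪ b, hb, by rw [Finset.card_union_of_disjoint hdisj]; omega⟩
      have hsw' : s ⊆ w'.1 := Finset.subset_union_left
      refine ⟨w', hsw', ?_, hJw.trans (hJ w w' hsw hsw' ?_)⟩
      · exact Finset.union_sdiff_cancel_left hdisj
      · have : w.1 ∩ (s ∪ b) = s ∪ (w.1 \ s ∩ b) := by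
          ext x
          simp only [Finset.mem_inter, Finset.mem_union, Finset.mem_sdiff]
          have h1 := @hsw x
          have h2 : x ∈ s → x ∉ b := fun h => Finset.disjoint_left.1 hdisj h
          tauto
        rw [show w'.1 = s ∪ b from rfl, this, Finset.card_union_of_disjoint
          (hdisj.mono_right Finset.inter_subset_right)]
        omega
  obtain ⟨w, hsw, hwv, hJw⟩ := key _ (hchain _ hul _ hvl (by omega) (by omega))
  have : w = v := by
    apply Subtype.ext
    rw [← Finset.union_sdiff_of_subset hsw, hwv, Finset.union_sdiff_of_subset hv]
  rw [hJw, this]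

/-- If the differences of `P` across the edges lie in the powers of the labels, the derivatives of
order at most `r` of `P u` and `P v` agree on `σ_u ∩ σ_v`, for any two `n`-simplices. -/
theorem iteratedFDeriv_eq_of_mem_dualLabel_pow
    (hdim : IsOfDimension Δ.toPreAbstractSimplicialComplex n)
    (hlink : ∀ s ∈ Δ.faces, IsStronglyConnected (link Δ.toPreAbstractSimplicialComplex s))
    {r : ℕ} {P : DualVertex Δ → MvPolynomial (Fin n) ℂ}
    (hP : ∀ (u v : DualVertex Δ) (h : (dualGraph Δ).Adj u v),
      P u - P v ∈ dualLabel Δ ⟨s(u, v), h⟩ ^ (r + 1))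
    {u v : DualVertex Δ} {x : EuclideanSpace ℝ (Fin n)} (hx : x ∈ u.simplex ∩ v.simplex)
    {k : ℕ} (hk : k ≤ r) :
    iteratedFDeriv ℝ k (fun y => evalReal y (P u)) x =
      iteratedFDeriv ℝ k (fun y => evalReal y (P v)) x := by
  classical
  have hx' : x ∈ convexHull ℝ ((u.1 ∩ v.1 : Finset _) : Set (EuclideanSpace ℝ (Fin n))) := by
    rw [Finset.coe_inter]
    exact Δ.inter_subset_convexHull u.2.1 v.2.1 hx
  have hne : (u.1 ∩ v.1).Nonempty :=
    Finset.coe_nonempty.1 (convexHull_nonempty_iff.1 ⟨x, hx'⟩)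
  have hs : u.1 ∩ v.1 ∈ Δ.faces := Δ.down_closed u.2.1 Finset.inter_subset_left hne
  -- Every simplex containing the common face of `u` and `v` contains `x`, so the edge conditions
  -- along a chain around that face all apply at `x`.
  have hadj : ∀ w w' : DualVertex Δ, u.1 ∩ v.1 ⊆ w.1 → u.1 ∩ v.1 ⊆ w'.1 →
      (dualGraph Δ).Adj w w' →
      iteratedFDeriv ℝ k (fun y => evalReal y (P w)) x =
        iteratedFDeriv ℝ k (fun y => evalReal y (P w')) x := by
    intro w w' hw hw' h
    have h0 := (mem_dualLabel_pow_iff h r _).1 (hP w w' h) k hk x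
      ⟨convexHull_mono (Finset.coe_subset.2 hw) hx', convexHull_mono (Finset.coe_subset.2 hw') hx'⟩
    have hsub : (fun y => evalReal y (P w - P w')) =
        (fun y => evalReal y (P w)) - fun y => evalReal y (P w') := by
      ext y; simp [evalReal]
    rw [hsub, iteratedFDeriv_sub_apply (contDiff_evalReal _).contDiffAt
      (contDiff_evalReal _).contDiffAt, sub_eq_zero] at h0
    exact h0
  let J : DualVertex Δ → ContinuousMultilinearMap ℝ (fun _ : Fin k => EuclideanSpace ℝ (Fin n)) ℂ :=
    fun w => iteratedFDeriv ℝ k (fun y => evalReal y (P w)) x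
  exact eq_of_forall_adj_eq (K := Δ.toPreAbstractSimplicialComplex) (J := J) hdim.2 (hlink _ hs)
    (fun w w' hw hw' h => hadj w w' hw hw' (by change (w.1 ∩ w'.1).card = n; convert h))
    (u := u) (v := v) Finset.inter_subset_left Finset.inter_subset_right

end Combinatorics

/-! ### Smoothness of piecewise polynomial functions -/

section Smoothness

theorem DualVertex.interior_simplex_nonempty (v : DualVertex Δ) :
    (interior v.simplex).Nonempty :=
  interior_convexHull_nonempty_iff_affineSpan_eq_top.2 v.affineSpan_eq_top

theorem DualVertex.uniqueDiffOn_simplex (v : DualVertex Δ) : UniqueDiffOn ℝ v.simplex :=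
  uniqueDiffOn_convex (convex_convexHull ℝ _) v.interior_simplex_nonempty

theorem DualVertex.isClosed_simplex (v : DualVertex Δ) : IsClosed v.simplex :=
  (v.1.finite_toSet.isCompact_convexHull ℝ).isClosed

/-- Each point lies in a convex `n`-simplex with nonempty interior, and uniqueness of derivatives
passes to larger sets. -/
theorem uniqueDiffOn_space
    (hdim : IsOfDimension Δ.toPreAbstractSimplicialComplex n)
    (hconn : IsStronglyConnected Δ.toPreAbstractSimplicialComplex) :
    UniqueDiffOn ℝ Δ.space := by
  intro x hx
  obtain ⟨v, hv⟩ := exists_mem_simplex hdim hconn hx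
  exact (v.uniqueDiffOn_simplex x hv).mono v.simplex_subset_space

/-- For a finite union the filter of neighbourhoods within it is the supremum of those within the
pieces. -/
theorem hasFDerivWithinAt_iUnion {ι E F : Type*} [Finite ι] [NormedAddCommGroup E]
    [NormedSpace ℝ E] [NormedAddCommGroup F] [NormedSpace ℝ F] {s : ι → Set E} {f : E → F}
    {f' : E →L[ℝ] F} {x : E} (h : ∀ i, HasFDerivWithinAt f f' (s i) x) :
    HasFDerivWithinAt f f' (⋃ i, s i) x := by
  simp only [hasFDerivWithinAt_iff_tendsto] at h ⊢
  rw [nhdsWithin_iUnion]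
  exact Filter.tendsto_iSup.2 h

/-- A function on `Δ` that is given on the `n`-simplices by polynomials whose derivatives of order
at most `r` agree on the intersections is of class `C^r`. -/
theorem isContDiff_of_iteratedFDeriv_eq (hfin : Δ.faces.Finite)
    (hdim : IsOfDimension Δ.toPreAbstractSimplicialComplex n)
    (hconn : IsStronglyConnected Δ.toPreAbstractSimplicialComplex)
    {r : ℕ} {P : DualVertex Δ → MvPolynomial (Fin n) ℂ}
    (hP : ∀ (u v : DualVertex Δ), ∀ x ∈ u.simplex ∩ v.simplex, ∀ k ≤ r,
      iteratedFDeriv ℝ k (fun y => evalReal y (P u)) x =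
        iteratedFDeriv ℝ k (fun y => evalReal y (P v)) x)
    {F : Δ.space → ℂ} (hF : ∀ v, AgreesOn F v (P v)) : IsContDiff r F := by
  classical
  have hfinite : Finite (DualVertex Δ) := (hfin.subset fun s hs => hs.1 :
    {s : Finset (EuclideanSpace ℝ (Fin n)) | s ∈ Δ.faces ∧ s.card = n + 1}.Finite).to_subtype
  have hspace := space_eq_iUnion_simplex hdim hconn
  have hex : ∀ x : EuclideanSpace ℝ (Fin n), x ∈ Δ.space → ∃ v : DualVertex Δ, x ∈ v.simplex :=
    fun x hx => exists_mem_simplex hdim hconn hx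
  -- The candidate Taylor series takes its terms from an arbitrary simplex containing `x`; up to
  -- order `r` the choice does not matter, by `hP`. The value `0` off `Δ` plays no role.
  let p : EuclideanSpace ℝ (Fin n) →
      FormalMultilinearSeries ℝ (EuclideanSpace ℝ (Fin n)) ℂ := fun x =>
    if hx : x ∈ Δ.space then ftaylorSeries ℝ (fun y => evalReal y (P (hex x hx).choose)) x else 0
  have hp : ∀ v : DualVertex Δ, ∀ x ∈ v.simplex, ∀ k ≤ r,
      p x k = iteratedFDeriv ℝ k (fun y => evalReal y (P v)) x := by
    intro v x hx k hk
    have hxs := v.simplex_subset_space hx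
    simp only [p, dif_pos hxs]
    exact hP _ v x ⟨(hex x hxs).choose_spec, hx⟩ k hk
  refine ⟨fun x => (p x 0).curry0, ?_, fun x => ?_⟩
  · refine HasFTaylorSeriesUpToOn.contDiffOn (f' := p) ⟨fun x _ => rfl, fun m hm x hx => ?_,
      fun m hm => ?_⟩
    · have hm' : m < r := by exact_mod_cast hm
      rw [hspace]
      refine hasFDerivWithinAt_iUnion fun v => ?_
      by_cases hxv : x ∈ v.simplex
      · have hT := ((contDiff_evalReal (P v) (m := (r : ℕ∞))).ftaylorSeries.fderiv m hm x)
        rw [hp v x hxv (m + 1) hm']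
        exact hT.hasFDerivWithinAt.congr (fun y hy => hp v y hy m hm'.le) (hp v x hxv m hm'.le)
      -- The simplex is closed and misses `x`, so the derivative condition within it is vacuous.
      · refine HasFDerivWithinAt.of_notMem_closure ?_
        rwa [v.isClosed_simplex.closure_eq]
    · have hm' : m ≤ r := by exact_mod_cast hm
      rw [hspace]
      refine (locallyFinite_of_finite _).continuousOn_iUnion (fun v => v.isClosed_simplex)
        fun v => ?_
      refine ContinuousOn.congr ?_ fun y hy => hp v y hy m hm'
      exact ((contDiff_evalReal (P v) (m := m)).continuous_iteratedFDeriv le_rfl).continuousOn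
  · obtain ⟨v, hv⟩ := hex x x.2
    rw [hF v x hv]
    exact congrArg (fun m => m 0) (hp v x hv 0 (Nat.zero_le _)).symm

/-- Derivatives within `Δ` restrict to `σ_v`, since both sets have unique derivatives, and there `g`
is `P`. The right side does not involve `v`, so neighbouring polynomials can be compared. -/
theorem iteratedFDeriv_eq_of_contDiffOn
    (hdim : IsOfDimension Δ.toPreAbstractSimplicialComplex n)
    (hconn : IsStronglyConnected Δ.toPreAbstractSimplicialComplex) {r k : ℕ} (hk : k ≤ r)
    {g : EuclideanSpace ℝ (Fin n) → ℂ} (hg : ContDiffOn ℝ (r : ℕ∞) g Δ.space)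
    {v : DualVertex Δ} {P : MvPolynomial (Fin n) ℂ} (hP : ∀ x ∈ v.simplex, g x = evalReal x P)
    {x : EuclideanSpace ℝ (Fin n)} (hx : x ∈ v.simplex) :
    iteratedFDeriv ℝ k (fun y => evalReal y P) x = iteratedFDerivWithin ℝ k g Δ.space x := by
  rw [← iteratedFDerivWithin_subset v.simplex_subset_space v.uniqueDiffOn_simplex
    (uniqueDiffOn_space hdim hconn) (hg.of_le (by exact_mod_cast hk)) hx,
    iteratedFDerivWithin_congr hP hx,
    iteratedFDerivWithin_eq_iteratedFDeriv v.uniqueDiffOn_simplex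
      (contDiff_evalReal _).contDiffAt hx]

/-- The Billera–Rose criterion: a function given by polynomials on the `n`-simplices is of class
`C^r` exactly when the differences across the edges of the dual graph lie in the `(r + 1)`-st powers
of the labels. -/
theorem isContDiff_iff_mem_dualLabel_pow (hfin : Δ.faces.Finite)
    (hdim : IsOfDimension Δ.toPreAbstractSimplicialComplex n)
    (hconn : IsStronglyConnected Δ.toPreAbstractSimplicialComplex)
    (hlink : ∀ s ∈ Δ.faces, IsStronglyConnected (link Δ.toPreAbstractSimplicialComplex s))
    {r : ℕ} {P : DualVertex Δ → MvPolynomial (Fin n) ℂ} {F : Δ.space → ℂ}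
    (hF : ∀ v, AgreesOn F v (P v)) :
    IsContDiff r F ↔ ∀ (u v : DualVertex Δ) (h : (dualGraph Δ).Adj u v),
      P u - P v ∈ dualLabel Δ ⟨s(u, v), h⟩ ^ (r + 1) := by
  refine ⟨?_, fun h => isContDiff_of_iteratedFDeriv_eq hfin hdim hconn
    (fun u v x hx k hk => iteratedFDeriv_eq_of_mem_dualLabel_pow hdim hlink h hx hk) hF⟩
  rintro ⟨g, hg, hFg⟩ u v h
  rw [mem_dualLabel_pow_iff]
  intro k hk x hx
  have hgP : ∀ w : DualVertex Δ, ∀ y ∈ w.simplex, g y = evalReal y (P w) := fun w y hy => by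
    rw [← hF w ⟨y, w.simplex_subset_space hy⟩ hy, hFg]
  have hsub : (fun y => evalReal y (P u - P v)) =
      (fun y => evalReal y (P u)) - fun y => evalReal y (P v) := by
    ext y; simp [evalReal]
  rw [hsub, iteratedFDeriv_sub_apply (contDiff_evalReal _).contDiffAt
    (contDiff_evalReal _).contDiffAt,
    iteratedFDeriv_eq_of_contDiffOn hdim hconn hk hg (hgP u) hx.1,
    iteratedFDeriv_eq_of_contDiffOn hdim hconn hk hg (hgP v) hx.2, sub_self]

end Smoothness

/-! ### The dual map -/

section DualMap

/-- Two polynomials that agree on `σ_v` agree on its affine span, which is `ℝⁿ`. This makes the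
choice in `dualMap` harmless and yields all its algebraic rules. -/
theorem dualMap_eq_of_agreesOn {F : Δ.space → ℂ} {v : DualVertex Δ}
    {P : MvPolynomial (Fin n) ℂ} (hP : AgreesOn F v P) : dualMap F v = P := by
  have hex : ∃ P : MvPolynomial (Fin n) ℂ, AgreesOn F v P := ⟨P, hP⟩
  have hspec : AgreesOn F v (dualMap F v) := by
    rw [dualMap, dif_pos hex]
    exact hex.choose_spec
  rw [← sub_eq_zero]
  refine evalReal_ext fun x => ?_
  rw [evalReal_eq_zero_of_mem_affineSpan (W := v.1) (fun y hy => ?_)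
    (v.affineSpan_eq_top ▸ AffineSubspace.mem_top ℝ _ x)]
  · simp [evalReal]
  · have h1 := hspec ⟨y, v.simplex_subset_space hy⟩ hy
    have h2 := hP ⟨y, v.simplex_subset_space hy⟩ hy
    simp only [evalReal] at h1 h2 ⊢
    rw [map_sub, ← h1, ← h2, sub_self]

variable {d : ℕ}

theorem IsPiecewisePolynomial.agreesOn_dualMap {F : Δ.space → ℂ}
    (hF : IsPiecewisePolynomial d F) (v : DualVertex Δ) : AgreesOn F v (dualMap F v) := by
  obtain ⟨P, -, hP⟩ := hF v
  rwa [dualMap_eq_of_agreesOn hP]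

theorem IsPiecewisePolynomial.totalDegree_dualMap_le {F : Δ.space → ℂ}
    (hF : IsPiecewisePolynomial d F) (v : DualVertex Δ) : (dualMap F v).totalDegree ≤ d := by
  obtain ⟨P, hPd, hP⟩ := hF v
  rwa [dualMap_eq_of_agreesOn hP]

theorem truncate_comp_mem_dualSplineRing_iff
    (hhom : ∀ e : (dualGraph Δ).edgeSet, ∃ (k : ℕ) (f : MvPolynomial (Fin n) ℂ),
      f.IsHomogeneous k ∧ dualLabel Δ e = Ideal.span {f})
    {P : DualVertex Δ → MvPolynomial (Fin n) ℂ} (hP : ∀ v, (P v).totalDegree ≤ d) (r : ℕ) :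
    (fun v => truncate n (d + 1) (P v)) ∈ dualSplineRing Δ r d ↔
      ∀ (u v : DualVertex Δ) (h : (dualGraph Δ).Adj u v),
        P u - P v ∈ dualLabel Δ ⟨s(u, v), h⟩ ^ (r + 1) := by
  change (∀ (u v : DualVertex Δ) (h : (dualGraph Δ).Adj u v), _) ↔ _
  refine forall_congr' fun u => forall_congr' fun v => forall_congr' fun h => ?_
  obtain ⟨k, f, hf, hspan⟩ := hhom ⟨s(u, v), h⟩
  rw [← map_sub]
  exact truncate_mem_map_pow_iff hf hspan
    ((totalDegree_sub _ _).trans (max_le (hP u) (hP v))) (r + 1)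

theorem mem_splineSpace_iff_reducedDual_mem (hfin : Δ.faces.Finite)
    (hdim : IsOfDimension Δ.toPreAbstractSimplicialComplex n)
    (hconn : IsStronglyConnected Δ.toPreAbstractSimplicialComplex)
    (hlink : ∀ s ∈ Δ.faces, IsStronglyConnected (link Δ.toPreAbstractSimplicialComplex s))
    (hhom : ∀ e : (dualGraph Δ).edgeSet, ∃ (k : ℕ) (f : MvPolynomial (Fin n) ℂ),
      f.IsHomogeneous k ∧ dualLabel Δ e = Ideal.span {f})
    {r : ℕ} {F : Δ.space → ℂ} (hF : IsPiecewisePolynomial d F) :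
    F ∈ splineSpace Δ r d ↔ reducedDual d F ∈ dualSplineRing Δ r d := by
  have h1 : F ∈ splineSpace Δ r d ↔ IsContDiff r F := ⟨fun h => h.2, fun h => ⟨hF, h⟩⟩
  rw [h1, isContDiff_iff_mem_dualLabel_pow hfin hdim hconn hlink hF.agreesOn_dualMap]
  exact (truncate_comp_mem_dualSplineRing_iff hhom hF.totalDegree_dualMap_le r).symm

theorem eq_of_reducedDual_eq
    (hdim : IsOfDimension Δ.toPreAbstractSimplicialComplex n)
    (hconn : IsStronglyConnected Δ.toPreAbstractSimplicialComplex)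
    {F F' : Δ.space → ℂ} (hF : IsPiecewisePolynomial d F) (hF' : IsPiecewisePolynomial d F')
    (h : reducedDual d F = reducedDual d F') : F = F' := by
  have hdual : ∀ v, dualMap F v = dualMap F' v := fun v => by
    rw [← sub_eq_zero]
    refine eq_zero_of_mem_homogeneousIdeal (d := d) ((totalDegree_sub _ _).trans
      (max_le (hF.totalDegree_dualMap_le v) (hF'.totalDegree_dualMap_le v))) ?_
    exact Ideal.Quotient.eq.1 (congrFun h v)
  funext x
  obtain ⟨v, hv⟩ := exists_mem_simplex hdim hconn x.2
  rw [hF.agreesOn_dualMap v x hv, hF'.agreesOn_dualMap v x hv, hdual]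

/-- The representatives of degree at most `d` satisfy the untruncated edge conditions, so they glue
to a spline. -/
theorem exists_reducedDual_eq (hfin : Δ.faces.Finite)
    (hdim : IsOfDimension Δ.toPreAbstractSimplicialComplex n)
    (hconn : IsStronglyConnected Δ.toPreAbstractSimplicialComplex)
    (hlink : ∀ s ∈ Δ.faces, IsStronglyConnected (link Δ.toPreAbstractSimplicialComplex s))
    (hhom : ∀ e : (dualGraph Δ).edgeSet, ∃ (k : ℕ) (f : MvPolynomial (Fin n) ℂ),
      f.IsHomogeneous k ∧ dualLabel Δ e = Ideal.span {f})
    {r : ℕ} {p : DualVertex Δ → TruncatedRing n (d + 1)} (hp : p ∈ dualSplineRing Δ r d) :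
    ∃ F ∈ splineSpace Δ r d, reducedDual d F = p := by
  choose P hPd hPp using fun v => exists_totalDegree_le_truncate_eq (p v)
  obtain rfl : (fun v => truncate n (d + 1) (P v)) = p := funext hPp
  have hP := (truncate_comp_mem_dualSplineRing_iff hhom hPd r).1 hp
  have hex : ∀ x : Δ.space, ∃ v : DualVertex Δ, (x : EuclideanSpace ℝ (Fin n)) ∈ v.simplex :=
    fun x => exists_mem_simplex hdim hconn x.2
  choose w hw using hex
  have hF : ∀ v, AgreesOn (fun x => evalReal x.1 (P (w x))) v (P v) := fun v x hx => by
    -- Order `0` of the agreement of derivatives: the value at `x` does not depend on the chosen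
    -- simplex `w x`.
    have := iteratedFDeriv_eq_of_mem_dualLabel_pow hdim hlink hP ⟨hw x, hx⟩ (Nat.zero_le r)
    exact congrArg (fun m => m 0) this
  refine ⟨fun x => evalReal x.1 (P (w x)), ⟨fun v => ⟨P v, hPd v, hF v⟩, ?_⟩, ?_⟩
  · exact (isContDiff_iff_mem_dualLabel_pow hfin hdim hconn hlink hF).2 hP
  · funext v
    rw [reducedDual, dualMap_eq_of_agreesOn (hF v)]

/-- The map `F ↦ F̄*` on splines is linear. -/
def reducedDualLinearMap (Δ : Geometry.SimplicialComplex ℝ (EuclideanSpace ℝ (Fin n))) (r d : ℕ) :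
    splineSpace Δ r d →ₗ[ℂ] (DualVertex Δ → TruncatedRing n (d + 1)) where
  toFun F := reducedDual d F
  map_add' F F' := by
    funext v
    have : AgreesOn ((F : Δ.space → ℂ) + (F' : Δ.space → ℂ)) v
        (dualMap F v + dualMap F' v) := fun x hx => by
      have h1 := F.2.1.agreesOn_dualMap v x hx
      have h2 := F'.2.1.agreesOn_dualMap v x hx
      simp only [evalReal] at h1 h2
      simp [evalReal, h1, h2]
    simp only [Submodule.coe_add, reducedDual, Pi.add_apply]
    rw [dualMap_eq_of_agreesOn this, map_add]
  map_smul' c F := by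
    funext v
    have : AgreesOn (c • (F : Δ.space → ℂ)) v (c • dualMap F v) := fun x hx => by
      have h1 := F.2.1.agreesOn_dualMap v x hx
      simp only [evalReal] at h1
      simp [evalReal, h1]
    simp only [Submodule.coe_smul, reducedDual, Pi.smul_apply, RingHom.id_apply]
    rw [dualMap_eq_of_agreesOn this]
    rfl

/-- `dualMap` imposes no degree bound, so `f * F*(v)` is the dual value of the product whatever its
degree. -/
theorem reducedDual_polyMul {F : Δ.space → ℂ} (hF : IsPiecewisePolynomial d F)
    (f : MvPolynomial (Fin n) ℂ) :
    reducedDual d (polyMul f F) = truncate n (d + 1) f • reducedDual d F := by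
  funext v
  have : AgreesOn (polyMul f F) v (f * dualMap F v) := fun x hx => by
    have h1 := hF.agreesOn_dualMap v x hx
    simp only [evalReal] at h1
    simp [polyMul, evalReal, h1]
  simp only [reducedDual, Pi.smul_apply, smul_eq_mul]
  rw [dualMap_eq_of_agreesOn this, map_mul]

theorem reducedDual_mul {F F' : Δ.space → ℂ} (hF : IsPiecewisePolynomial d F)
    (hF' : IsPiecewisePolynomial d F') :
    reducedDual d (F * F') = reducedDual d F * reducedDual d F' := by
  funext v
  have : AgreesOn (F * F') v (dualMap F v * dualMap F' v) := fun x hx => by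
    have h1 := hF.agreesOn_dualMap v x hx
    have h2 := hF'.agreesOn_dualMap v x hx
    simp only [evalReal] at h1 h2
    simp [evalReal, h1, h2]
  simp only [reducedDual, Pi.mul_apply]
  rw [dualMap_eq_of_agreesOn this, map_mul]

end DualMap

end SplinePaper

end

theorem corollary5p7 (n r d : ℕ)
    (Δ : Geometry.SimplicialComplex ℝ (EuclideanSpace ℝ (Fin n)))
    (hfin : Δ.faces.Finite)
    (hdim : SplinePaper.IsOfDimension Δ.toPreAbstractSimplicialComplex n)
    (hconn : SplinePaper.IsStronglyConnected Δ.toPreAbstractSimplicialComplex)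
    (hlink : ∀ s ∈ Δ.faces, SplinePaper.IsStronglyConnected
      (SplinePaper.link Δ.toPreAbstractSimplicialComplex s))
    (hhom : ∀ e : (SplinePaper.dualGraph Δ).edgeSet,
      ∃ (k : ℕ) (f : MvPolynomial (Fin n) ℂ),
        f.IsHomogeneous k ∧ SplinePaper.dualLabel Δ e = Ideal.span {f}) :
    (∀ F : Δ.space → ℂ, SplinePaper.IsPiecewisePolynomial d F →
      (F ∈ SplinePaper.splineSpace Δ r d ↔
        SplinePaper.reducedDual d F ∈ SplinePaper.dualSplineRing Δ r d)) ∧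
    ∃ Φ : SplinePaper.splineSpace Δ r d ≃ₗ[ℂ] SplinePaper.dualSplineRing Δ r d,
      (∀ F : SplinePaper.splineSpace Δ r d,
        (Φ F : SplinePaper.DualVertex Δ → SplinePaper.TruncatedRing n (d + 1)) =
          SplinePaper.reducedDual d (F : Δ.space → ℂ)) ∧
      (∀ (f : MvPolynomial (Fin n) ℂ) (p : SplinePaper.splineSpace Δ r d)
        (h : SplinePaper.polyMul f (p : Δ.space → ℂ) ∈ SplinePaper.splineSpace Δ r d),
          Φ ⟨SplinePaper.polyMul f (p : Δ.space → ℂ), h⟩ =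
            SplinePaper.truncate n (d + 1) f • Φ p) ∧
      (∀ (p₁ p₂ : SplinePaper.splineSpace Δ r d)
        (h : (p₁ : Δ.space → ℂ) * (p₂ : Δ.space → ℂ) ∈ SplinePaper.splineSpace Δ r d),
          Φ ⟨(p₁ : Δ.space → ℂ) * (p₂ : Δ.space → ℂ), h⟩ = Φ p₁ * Φ p₂) := by
  have hmem : ∀ F : SplinePaper.splineSpace Δ r d,
      SplinePaper.reducedDualLinearMap Δ r d F ∈ SplinePaper.dualSplineRing Δ r d := fun F =>
    (SplinePaper.mem_splineSpace_iff_reducedDual_mem hfin hdim hconn hlink hhom F.2.1).1 F.2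
  let Ψ : SplinePaper.splineSpace Δ r d →ₗ[ℂ] SplinePaper.dualSplineRing Δ r d :=
    { toFun := fun F => ⟨SplinePaper.reducedDualLinearMap Δ r d F, hmem F⟩
      map_add' := fun F F' => Subtype.ext (map_add (SplinePaper.reducedDualLinearMap Δ r d) F F')
      map_smul' := fun c F =>
        Subtype.ext (map_smul (SplinePaper.reducedDualLinearMap Δ r d) c F) }
  have hΨ : Function.Bijective Ψ := by
    refine ⟨fun F F' h => Subtype.ext ?_, fun p => ?_⟩
    · exact SplinePaper.eq_of_reducedDual_eq hdim hconn F.2.1 F'.2.1 (congrArg Subtype.val h)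
    · obtain ⟨F, hF, hFp⟩ := SplinePaper.exists_reducedDual_eq hfin hdim hconn hlink hhom p.2
      exact ⟨⟨F, hF⟩, Subtype.ext hFp⟩
  refine ⟨fun F hF => SplinePaper.mem_splineSpace_iff_reducedDual_mem hfin hdim hconn hlink hhom hF,
    LinearEquiv.ofBijective Ψ hΨ, fun F => rfl, fun f p h => Subtype.ext ?_,
    fun p₁ p₂ h => Subtype.ext ?_⟩
  · exact SplinePaper.reducedDual_polyMul p.2.1 f
  · exact SplinePaper.reducedDual_mul p₁.2.1 p₂.2.1
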